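/- Let $n\ge 1$ and $N=n+1$, and write points of $\mathbb{R}^N=\mathbb{R}^{n}\times\mathbb{R}$ as $x=(x',x_N)$. Let $\omega\subset\mathbb{R}^{n}$ be a bounded domain (nonempty, open, connected) with $C^\infty$ boundary, let $\mathcal{C}_\omega=\omega\times(0,+\infty)$ be the half-cylinder spanned by $\omega$, and let $\partial\mathcal{C}_\omega^+=\partial\mathcal{C}_\omega\cap\{x_N>0\}$ be the lateral part of its boundary. Let $\varphi\in C^2(\bar\omega)$ satisfy $\varphi>0$ on $\bar\omega$, and let $$\Gamma_\varphi=\{(x',x_N): x'\in\omega,\ x_N=\varphi(x')\}\subset\mathcal{C}_\omega$$ be its cartesian graph. The mean curvature of $\Gamma_\varphi$ at a point is $\frac1{N-1}$ times the trace of the shape operator $v\mapsto D_v\nu$ on the tangent space of $\Gamma_\varphi$, where $\nu$ is the unit normal field of $\Gamma_\varphi$ exterior to $\Omega_\varphi=\{(x',x_N): x'\in\omega,\ 0<x_N<\varphi(x')\}$. Assume that 1. $\Gamma_\varphi$ has constant mean curvature $H$, and 2. $\Gamma_\varphi$ meets $\partial\mathcal{C}_\omega^+$ orthogonally, that is, at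 every point of $\overline{\Gamma_\varphi}\cap\partial\mathcal{C}_\omega^+$ the normals to $\overline{\Gamma_\varphi}$ and to $\partial\mathcal{C}_\omega^+$ are orthogonal. Then $H=0$, i.e. $\Gamma_\varphi$ is a minimal hypersurface, and $\varphi$ is constant on $\bar\omega$. -/

import Mathlib

open scoped Topology

noncomputable section

namespace CMCGraph

/-- `ℝⁿ` with its Euclidean structure. -/
abbrev Base (n : ℕ) : Type := EuclideanSpace ℝ (Fin n)

/-- `ℝᴺ = ℝⁿ × ℝ`, `N = n + 1`, with its Euclidean structure; a point is `x = (x', x_N)`,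
where `x' = x.fst` and `x_N = x.snd`. -/
abbrev Ambient (n : ℕ) : Type := WithLp 2 (Base n × ℝ)

/-- A smooth bounded domain: a nonempty bounded connected open set which near each of its boundary
points is the sublevel set of a `C^∞` function with nonvanishing differential. -/
structure IsSmoothBoundedDomain {n : ℕ} (ω : Set (Base n)) : Prop where
  isOpen : IsOpen ω
  isConnected : IsConnected ω
  isBounded : Bornology.IsBounded ω
  smooth_boundary : ∀ p ∈ frontier ω, ∃ (U : Set (Base n)) (ρ : Base n → ℝ),
    IsOpen U ∧ p ∈ U ∧ ContDiffOn ℝ ((⊤ : ℕ∞) : WithTop ℕ∞) ρ U ∧ fderiv ℝ ρ p ≠ 0 ∧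
      ω ∩ U = {x | x ∈ U ∧ ρ x < 0}

/-- The half-cylinder `ω × (0, ∞)`. -/
def halfCylinder {n : ℕ} (ω : Set (Base n)) : Set (Ambient n) :=
  {x | x.fst ∈ ω ∧ 0 < x.snd}

/-- The lateral part `∂(ω × (0, ∞)) ∩ {x_N > 0}` of the boundary of the half-cylinder. -/
def lateralBoundary {n : ℕ} (ω : Set (Base n)) : Set (Ambient n) :=
  frontier (halfCylinder ω) ∩ {x | 0 < x.snd}

/-- The cartesian graph of `φ` over `ω`. -/
def graph {n : ℕ} (ω : Set (Base n)) (φ : Base n → ℝ) : Set (Ambient n) :=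
  {x | x.fst ∈ ω ∧ x.snd = φ x.fst}

/-- The part of the half-cylinder below the graph of `φ`. -/
def subgraph {n : ℕ} (ω : Set (Base n)) (φ : Base n → ℝ) : Set (Ambient n) :=
  {x | x.fst ∈ ω ∧ 0 < x.snd ∧ x.snd < φ x.fst}

section Geometry

variable {E : Type*} [NormedAddCommGroup E] [InnerProductSpace ℝ E] [FiniteDimensional ℝ E]

/-- The tangent space of `S` at `p`, spanned by the limits of (rescaled) secants of `S` at `p`.
For a `C¹` hypersurface, with or without boundary, this is the usual tangent hyperplane. -/
def tangentSpaceAt (S : Set E) (p : E) : Submodule ℝ E :=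
  Submodule.span ℝ (tangentConeAt ℝ S p)

/-- The normal space of `S` at `p`. -/
def normalSpaceAt (S : Set E) (p : E) : Submodule ℝ E :=
  (tangentSpaceAt S p)ᗮ

/-- `ν` is, along `Γ`, the unit normal field pointing out of `Ω`
(`Γ` being a part of the boundary of `Ω`). -/
structure IsExteriorUnitNormal (Ω Γ : Set E) (ν : E → E) : Prop where
  norm_eq_one : ∀ p ∈ Γ, ‖ν p‖ = 1
  normal : ∀ p ∈ Γ, ν p ∈ normalSpaceAt Γ p
  outside : ∀ p ∈ Γ, ∀ᶠ t : ℝ in 𝓝[>] 0, p + t • ν p ∉ Ω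
  inside : ∀ p ∈ Γ, ∀ᶠ t : ℝ in 𝓝[>] 0, p - t • ν p ∈ Ω

/-- The shape operator `v ↦ D_v ν` of `Γ` at `p`, as an endomorphism of the tangent space
(positive on round spheres with the exterior normal). -/
def shapeOperator (Γ : Set E) (ν : E → E) (p : E) :
    tangentSpaceAt Γ p →ₗ[ℝ] tangentSpaceAt Γ p :=
  (tangentSpaceAt Γ p).orthogonalProjectionOnto.toLinearMap ∘ₗ
    (fderivWithin ℝ ν Γ p).toLinearMap ∘ₗ (tangentSpaceAt Γ p).subtype

/-- The mean curvature at `p` of the hypersurface `Γ` with unit normal field `ν`: the trace of the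
shape operator divided by the dimension of `Γ`. -/
def meanCurvature (Γ : Set E) (ν : E → E) (p : E) : ℝ :=
  LinearMap.trace ℝ (tangentSpaceAt Γ p) (shapeOperator Γ ν p) /
    Module.finrank ℝ (tangentSpaceAt Γ p)

/-- `Γ` has constant mean curvature `H` with respect to the unit normal exterior to `Ω`. -/
def HasConstantMeanCurvature (Ω Γ : Set E) (H : ℝ) : Prop :=
  ∃ ν : E → E, IsExteriorUnitNormal Ω Γ ν ∧ DifferentiableOn ℝ ν Γ ∧
    ∀ p ∈ Γ, meanCurvature Γ ν p = H

/-- The hypersurface `Γ` meets the hypersurface `S` orthogonally: at every common point of `S` and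
of the closure of `Γ` the normals to the two hypersurfaces are orthogonal. -/
def MeetsOrthogonally (Γ S : Set E) : Prop :=
  ∀ p ∈ closure Γ ∩ S, ∀ a ∈ normalSpaceAt (closure Γ) p, ∀ b ∈ normalSpaceAt S p,
    inner ℝ a b = 0

end Geometry

end CMCGraph

end

/-! Write `Q(φ) = (1 + |∇φ|²) Δφ - ∇²φ(∇φ, ∇φ)`. With the upward normal, the curvature hypothesis
reads `Q(φ) = -n H (1 + |∇φ|²)^(3/2)` on `ω`, and orthogonality to the cylinder is the homogeneous
Neumann condition. So `Q(φ)` has a constant sign: `φ` is a subsolution if `H ≤ 0`, and `-φ` is one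
if `H ≥ 0`.

A subsolution `u` with Neumann data is constant. It attains its maximum on the compact closure. If
this happens only on the boundary, the Neumann condition forces the whole differential to vanish
there, against Hopf's lemma on an interior touching ball (`not_hasFDerivWithinAt_zero_of_max`,
`exists_ball_subset_sublevel`). If it happens inside, Hopf's lemma again shows that the set of
maxima is open, and connectedness concludes (`eq_const_of_subsolution`). Once `φ` is constant, `Q(φ)
= 0` gives `H = 0`. The maximum principle thus replaces the integration of the equation in
divergence form.

The geometric input is `minimalOperator_eq_of_meanCurvature` and
`inner_eq_zero_of_meetsOrthogonally`. -/

noncomputable section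

namespace CMCGraph

/-! ### The minimal surface operator and Hopf's boundary point lemma -/

section Analysis

open Metric Set Filter
open scoped Gradient RealInnerProductSpace

/-- At a local maximum the second derivative is nonpositive. -/
theorem second_deriv_nonpos_of_isLocalMax {f f' : ℝ → ℝ} {a c : ℝ}
    (hf : ∀ᶠ t in 𝓝 a, HasDerivAt f (f' t) t) (hf' : HasDerivAt f' c a)
    (hmax : IsLocalMax f a) : c ≤ 0 := by
  by_contra! hc
  have hd : deriv f =ᶠ[𝓝 a] f' := hf.mono fun t ht => ht.deriv
  -- If `c > 0`, the second derivative test makes `a` a local minimum too, so `f` is locally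
  -- constant and `c = 0`.
  have hmin : IsLocalMin f a := by
    refine isLocalMin_of_deriv_deriv_pos ?_ hmax.deriv_eq_zero hf.self_of_nhds.continuousAt
    rw [hd.deriv_eq, hf'.deriv]
    exact hc
  have hconst : f =ᶠ[𝓝 a] fun _ => f a := by
    filter_upwards [hmax, hmin] with t h1 h2 using le_antisymm h1 h2
  have hd0 : deriv f =ᶠ[𝓝 a] fun _ => 0 := by
    simpa using hconst.deriv
  have : f' =ᶠ[𝓝 a] fun _ => 0 := hd.symm.trans hd0
  have h0 := (hf'.congr_of_eventuallyEq this.symm).unique (hasDerivAt_const a (0 : ℝ))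
  linarith

variable {E : Type*} [NormedAddCommGroup E] [InnerProductSpace ℝ E]

/-- The minimal surface operator in nondivergence form, for a function with gradient `g` and
Hessian `M`: `(1 + |g|²) tr M - ⟨g, M g⟩`. -/
def minimalOperator (g : E) (M : E →ₗ[ℝ] E) : ℝ :=
  (1 + ‖g‖ ^ 2) * LinearMap.trace ℝ E M - ⟪g, M g⟫

theorem minimalOperator_add (g : E) (M M' : E →ₗ[ℝ] E) :
    minimalOperator g (M + M') = minimalOperator g M + minimalOperator g M' := by
  simp only [minimalOperator, map_add, LinearMap.add_apply, inner_add_right]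
  ring

theorem minimalOperator_smul (g : E) (c : ℝ) (M : E →ₗ[ℝ] E) :
    minimalOperator g (c • M) = c * minimalOperator g M := by
  simp only [minimalOperator, map_smul, LinearMap.smul_apply, inner_smul_right, smul_eq_mul]
  ring

/-- Up to the positive factor `2 α exp (-α |x|²)`, the Hessian at `x` of the Gaussian
`exp (-α |x|²)`. -/
def gaussianHessian (α : ℝ) (x : E) : E →ₗ[ℝ] E :=
  (2 * α) • (innerₗ E x).smulRight x - LinearMap.id

theorem inner_gaussianHessian (α : ℝ) (x v : E) :
    ⟪v, gaussianHessian α x v⟫ = 2 * α * ⟪x, v⟫ ^ 2 - ‖v‖ ^ 2 := by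
  simp only [gaussianHessian, LinearMap.sub_apply, LinearMap.smul_apply,
    LinearMap.smulRight_apply, innerₗ_apply_apply, LinearMap.id_apply, inner_sub_right,
    inner_smul_right, real_inner_self_eq_norm_sq]
  rw [real_inner_comm x v]
  ring

variable [FiniteDimensional ℝ E]

/-- The minimal surface operator is (degenerate) elliptic. -/
theorem minimalOperator_nonpos {M : E →ₗ[ℝ] E} (hM : ∀ v, ⟪v, M v⟫ ≤ 0) (g : E) :
    minimalOperator g M ≤ 0 := by
  let b := stdOrthonormalBasis ℝ E
  have htr : LinearMap.trace ℝ E M = ∑ i, ⟪b i, M (b i)⟫ := M.trace_eq_sum_inner b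
  have hnorm : ‖g‖ ^ 2 = ∑ i, ⟪b i, g⟫ ^ 2 := (b.sum_sq_inner_right g).symm
  have hg : g = ∑ i, ⟪b i, g⟫ • b i := (b.sum_repr' g).symm
  have hgM : ⟪g, M g⟫ = ∑ i, ∑ j, ⟪b i, g⟫ * ⟪b j, g⟫ * ⟪b i, M (b j)⟫ := by
    conv_lhs => rw [hg]
    simp only [map_sum, map_smul, sum_inner, inner_sum, inner_smul_left, inner_smul_right,
      RCLike.conj_to_real, Finset.mul_sum]
    rw [Finset.sum_comm]
    refine Finset.sum_congr rfl fun i _ => Finset.sum_congr rfl fun j _ => ?_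
    ring
  have hgM' : ⟪g, M g⟫ = ∑ i, ∑ j, ⟪b i, g⟫ * ⟪b j, g⟫ * ⟪b j, M (b i)⟫ := by
    rw [hgM, Finset.sum_comm]
    refine Finset.sum_congr rfl fun i _ => Finset.sum_congr rfl fun j _ => ?_
    ring
  have htr1 : ‖g‖ ^ 2 * LinearMap.trace ℝ E M
      = ∑ i, ∑ j, ⟪b i, g⟫ ^ 2 * ⟪b j, M (b j)⟫ := by
    rw [hnorm, htr, Finset.sum_mul_sum]
  have htr2 : ‖g‖ ^ 2 * LinearMap.trace ℝ E M
      = ∑ i, ∑ j, ⟪b j, g⟫ ^ 2 * ⟪b i, M (b i)⟫ := by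
    rw [htr1, Finset.sum_comm]
  -- Lagrange's identity: `|g|² tr M - ⟨g, M g⟩` is half a sum of values of the quadratic form of
  -- `M`. Both orders of summation are prepared above because `M` need not be symmetric.
  have key : ∑ i, ∑ j, ⟪⟪b i, g⟫ • b j - ⟪b j, g⟫ • b i,
        M (⟪b i, g⟫ • b j - ⟪b j, g⟫ • b i)⟫
      = 2 * (‖g‖ ^ 2 * LinearMap.trace ℝ E M - ⟪g, M g⟫) := by
    have : 2 * (‖g‖ ^ 2 * LinearMap.trace ℝ E M - ⟪g, M g⟫)
        = ‖g‖ ^ 2 * LinearMap.trace ℝ E M + ‖g‖ ^ 2 * LinearMap.trace ℝ E M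
          - ⟪g, M g⟫ - ⟪g, M g⟫ := by ring
    rw [this]
    nth_rewrite 1 [htr1]
    rw [htr2]
    nth_rewrite 1 [hgM]
    rw [hgM']
    simp only [← Finset.sum_add_distrib, ← Finset.sum_sub_distrib]
    refine Finset.sum_congr rfl fun i _ => Finset.sum_congr rfl fun j _ => ?_
    simp only [map_sub, map_smul, inner_sub_left, inner_sub_right, inner_smul_left,
      inner_smul_right, RCLike.conj_to_real]
    ring
  have h1 : ∑ i, ∑ j, ⟪⟪b i, g⟫ • b j - ⟪b j, g⟫ • b i,
        M (⟪b i, g⟫ • b j - ⟪b j, g⟫ • b i)⟫ ≤ 0 :=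
    Finset.sum_nonpos fun i _ => Finset.sum_nonpos fun j _ => hM _
  have h2 : LinearMap.trace ℝ E M ≤ 0 := htr ▸ Finset.sum_nonpos fun i _ => hM _
  unfold minimalOperator
  linarith

/-- By Cauchy–Schwarz the rank-one part of the Hessian contributes at least `2α|x|²`, and the
identity part costs at most `dim E (1 + K²)`. Away from the origin the Gaussian is therefore a
strict subsolution for large `α`, uniformly in `|g| ≤ K`. -/
theorem minimalOperator_gaussianHessian_ge {α : ℝ} (hα : 0 ≤ α) {K : ℝ} {g : E} (hg : ‖g‖ ≤ K)
    (x : E) : 2 * α * ‖x‖ ^ 2 - Module.finrank ℝ E * (1 + K ^ 2)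
      ≤ minimalOperator g (gaussianHessian α x) := by
  have htr : LinearMap.trace ℝ E (gaussianHessian α x)
      = 2 * α * ‖x‖ ^ 2 - Module.finrank ℝ E := by
    simp [gaussianHessian, LinearMap.trace_smulRight]
  have hcs : ⟪x, g⟫ ^ 2 ≤ ‖x‖ ^ 2 * ‖g‖ ^ 2 := by
    rw [← mul_pow]
    exact sq_le_sq' (neg_le_of_abs_le (abs_real_inner_le_norm x g)) (real_inner_le_norm x g)
  rw [minimalOperator, htr, inner_gaussianHessian]
  have hg2 : ‖g‖ ^ 2 ≤ K ^ 2 := by gcongr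
  have h1 : (Module.finrank ℝ E : ℝ) * ‖g‖ ^ 2 ≤ Module.finrank ℝ E * K ^ 2 := by gcongr
  have h2 : 2 * α * ⟪x, g⟫ ^ 2 ≤ 2 * α * (‖x‖ ^ 2 * ‖g‖ ^ 2) := by gcongr
  nlinarith [sq_nonneg ‖g‖]

theorem differentiableAt_gradient {u : E → ℝ} {x : E} (hu : ContDiffAt ℝ 2 u x) :
    DifferentiableAt ℝ (∇ u) x := by
  have h : DifferentiableAt ℝ (fderiv ℝ u) x :=
    (hu.fderiv_right (m := 1) (by norm_num)).differentiableAt (by norm_num)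
  exact (InnerProductSpace.toDual ℝ E).symm.toContinuousLinearEquiv.differentiableAt.comp x h

theorem inner_gradient {u : E → ℝ} (x v : E) : ⟪∇ u x, v⟫ = fderiv ℝ u x v := by
  rw [← toDual_gradient]
  rfl

/-- Second order condition at a local maximum of a `C²` function plus a multiple of a Gaussian. -/
theorem hessian_add_gaussian_nonpos {u : E → ℝ} {x y : E} {α ε : ℝ} (hu : ContDiffAt ℝ 2 u x)
    (hmax : IsLocalMax (fun p => u p + ε * Real.exp (-α * ‖p - y‖ ^ 2)) x) (v : E) :
    ⟪v, ((fderiv ℝ (∇ u) x).toLinearMap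
      + (ε * (2 * α * Real.exp (-α * ‖x - y‖ ^ 2))) • gaussianHessian α (x - y)) v⟫ ≤ 0 := by
  have hline : ∀ t : ℝ, HasDerivAt (fun t : ℝ => x + t • v) v t := fun t => by
    simpa using ((hasDerivAt_id t).smul_const v).const_add x
  have hcont : Tendsto (fun t : ℝ => x + t • v) (𝓝 0) (𝓝 x) := by
    simpa [ContinuousAt] using (hline 0).continuousAt
  have hdiff : ∀ᶠ p in 𝓝 x, DifferentiableAt ℝ u p :=
    (hu.eventually (by norm_num)).mono fun p hp => hp.differentiableAt (by norm_num)
  have hmax' : IsLocalMax (fun t : ℝ => u (x + t • v)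
      + ε * Real.exp (-α * ‖x + t • v - y‖ ^ 2)) 0 := by
    have := hcont.eventually hmax
    simpa [IsLocalMax, IsMaxFilter] using this
  have hsq : ∀ t : ℝ, HasDerivAt (fun t : ℝ => ‖x + t • v - y‖ ^ 2)
      (2 * ⟪x + t • v - y, v⟫) t := fun t => by
    simpa using ((hline t).sub_const y).norm_sq
  have hexp : ∀ t : ℝ, HasDerivAt (fun t : ℝ => Real.exp (-α * ‖x + t • v - y‖ ^ 2))
      (Real.exp (-α * ‖x + t • v - y‖ ^ 2) * (-α * (2 * ⟪x + t • v - y, v⟫))) t := fun t =>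
    ((hsq t).const_mul (-α)).exp
  have hinner : HasDerivAt (fun t : ℝ => ⟪x + t • v - y, v⟫) ⟪v, v⟫ 0 := by
    simpa using ((hline 0).sub_const y).inner ℝ (hasDerivAt_const (0 : ℝ) v)
  have hgrad : HasDerivAt (fun t : ℝ => ⟪∇ u (x + t • v), v⟫) ⟪fderiv ℝ (∇ u) x v, v⟫ 0 := by
    have h0 : HasFDerivAt (∇ u) (fderiv ℝ (∇ u) x) (x + (0 : ℝ) • v) := by
      simpa using (differentiableAt_gradient hu).hasFDerivAt
    simpa using (h0.comp_hasDerivAt (0 : ℝ) (hline 0)).inner ℝ (hasDerivAt_const (0 : ℝ) v)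
  have hfirst : ∀ᶠ t : ℝ in 𝓝 0, HasDerivAt (fun t : ℝ => u (x + t • v)
      + ε * Real.exp (-α * ‖x + t • v - y‖ ^ 2))
      (⟪∇ u (x + t • v), v⟫
        + ε * (Real.exp (-α * ‖x + t • v - y‖ ^ 2) * (-α * (2 * ⟪x + t • v - y, v⟫)))) t := by
    filter_upwards [hcont.eventually hdiff] with t ht
    refine HasDerivAt.add ?_ ((hexp t).const_mul ε)
    rw [inner_gradient]
    exact ht.hasFDerivAt.comp_hasDerivAt t (hline t)
  have hsecond := hgrad.add (((hexp 0).mul ((hinner.const_mul 2).const_mul (-α))).const_mul ε)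
  have := second_deriv_nonpos_of_isLocalMax hfirst hsecond hmax'
  simp only [zero_smul, add_zero] at this
  rw [LinearMap.add_apply, inner_add_right, LinearMap.smul_apply, inner_smul_right,
    inner_gaussianHessian]
  rw [real_inner_self_eq_norm_sq, real_inner_comm v] at this
  simp only [ContinuousLinearMap.coe_coe]
  linarith

/-- **Hopf's boundary point lemma** for subsolutions of the minimal surface equation on a ball:
at a boundary point where the maximum is attained, the differential does not vanish. -/
theorem not_hasFDerivWithinAt_zero_of_max {u : E → ℝ} {y z : E} {R K M : ℝ} (hR : 0 < R)
    (hz : dist z y = R) (hu : ContDiffOn ℝ 2 u (ball y R)) (huc : ContinuousOn u (closedBall y R))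
    (hK : ∀ x ∈ ball y R, ‖∇ u x‖ ≤ K)
    (hsub : ∀ x ∈ ball y R, 0 ≤ minimalOperator (∇ u x) (fderiv ℝ (∇ u) x).toLinearMap)
    (hlt : ∀ x ∈ ball y R, u x < M) (huz : u z = M) :
    ¬ HasFDerivWithinAt u (0 : E →L[ℝ] ℝ) (ball y R) z := by
  intro hder
  have hle : ∀ x ∈ closedBall y R, u x ≤ M := by
    intro x hx
    rw [← closure_ball y hR.ne'] at hx huc
    exact closure_minimal (t := Iic M) (by rintro _ ⟨p, hp, rfl⟩; exact (hlt p hp).le) isClosed_Iic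
      (huc.image_closure (mem_image_of_mem u hx))
  obtain ⟨q, hq, hqmax⟩ := (isCompact_closedBall y (R / 2)).exists_isMaxOn
    (nonempty_closedBall.2 (by positivity)) (huc.mono (closedBall_subset_closedBall (by linarith)))
  have hqM : u q < M := hlt q (closedBall_subset_ball (by linarith) hq)
  -- The gap on the half ball: since the Gaussian is at most `1`, adding `ε` times it keeps `w ≤ M`
  -- there.
  set ε := M - u q with hε
  have hε0 : 0 < ε := by linarith
  -- Chosen so that `2α(R/2)² = αR²/2` exceeds `dim E (1 + K²)`: the Gaussian is a strict
  -- subsolution where `|x - y| > R/2`.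
  set α : ℝ := (2 * (Module.finrank ℝ E * (1 + K ^ 2)) + 1) / R ^ 2 with hα
  have hα0 : 0 < α := by positivity
  have hαR : α * R ^ 2 = 2 * (Module.finrank ℝ E * (1 + K ^ 2)) + 1 := by
    rw [hα]; field_simp
  set w : E → ℝ := fun p => u p + ε * Real.exp (-α * ‖p - y‖ ^ 2) with hw
  have hwc : ContinuousOn w (closedBall y R) := huc.add (by fun_prop)
  have hexpR : 0 < Real.exp (-α * R ^ 2) := Real.exp_pos _
  -- The bound is `w z`. It holds on the half ball by the choice of `ε` and on the sphere because `u
  -- ≤ M`; a maximum of `w` inside the annulus would contradict ellipticity.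
  have hwle : ∀ x ∈ closedBall y R, w x ≤ M + ε * Real.exp (-α * R ^ 2) := by
    obtain ⟨x, hx, hxmax⟩ := (isCompact_closedBall y R).exists_isMaxOn
      (nonempty_closedBall.2 hR.le) hwc
    suffices h : w x ≤ M + ε * Real.exp (-α * R ^ 2) from fun p hp => (hxmax hp).trans h
    rcases le_or_gt (dist x y) (R / 2) with hx1 | hx1
    · have h1 : u x ≤ u q := hqmax (mem_closedBall.2 hx1)
      have h2 : Real.exp (-α * ‖x - y‖ ^ 2) ≤ 1 := by
        rw [Real.exp_le_one_iff]
        have : 0 ≤ α * ‖x - y‖ ^ 2 := by positivity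
        linarith
      have h3 : ε * Real.exp (-α * ‖x - y‖ ^ 2) ≤ ε * 1 := by gcongr
      have h4 : 0 < ε * Real.exp (-α * R ^ 2) := by positivity
      simp only [hw]
      linarith
    rcases (mem_closedBall.1 hx).eq_or_lt with hx2 | hx2
    · have := hle x hx
      simp only [hw, ← dist_eq_norm, hx2]
      linarith
    exfalso
    have hxb : x ∈ ball y R := hx2
    have hnhds : ball y R ∈ 𝓝 x := isOpen_ball.mem_nhds hxb
    have hloc : IsLocalMax w x := (hxmax.on_subset ball_subset_closedBall).isLocalMax hnhds
    have hop := minimalOperator_nonpos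
      (hessian_add_gaussian_nonpos (hu.contDiffAt hnhds) hloc) (∇ u x)
    rw [minimalOperator_add, minimalOperator_smul] at hop
    have h1 := hsub x hxb
    have h2 := minimalOperator_gaussianHessian_ge hα0.le (hK x hxb) (x - y)
    have h3 : (R / 2) ^ 2 < ‖x - y‖ ^ 2 := by
      rw [← dist_eq_norm]; gcongr
    have h4 : 2 * α * (R / 2) ^ 2 < 2 * α * ‖x - y‖ ^ 2 := by gcongr
    have h5 : 2 * α * (R / 2) ^ 2 = α * R ^ 2 / 2 := by ring
    have h6 : 0 < minimalOperator (∇ u x) (gaussianHessian α (x - y)) := by linarith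
    have h7 : 0 < ε * (2 * α * Real.exp (-α * ‖x - y‖ ^ 2))
        * minimalOperator (∇ u x) (gaussianHessian α (x - y)) := by positivity
    linarith
  have hzR : ‖z - y‖ = R := by rw [← dist_eq_norm, hz]
  have hline : HasDerivAt (fun t : ℝ => z + t • (y - z)) (y - z) 0 := by
    simpa using ((hasDerivAt_id (0 : ℝ)).smul_const (y - z)).const_add z
  have hdist : ∀ t : ℝ, ‖z + t • (y - z) - y‖ = |1 - t| * R := fun t => by
    rw [show z + t • (y - z) - y = (1 - t) • (z - y) by module, norm_smul, hzR, Real.norm_eq_abs]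
  have hmaps : MapsTo (fun t : ℝ => z + t • (y - z)) (Ioo 0 1) (ball y R) := fun t ht => by
    rw [mem_ball, dist_eq_norm, hdist, abs_of_pos (by linarith [ht.2])]
    nlinarith [ht.1]
  -- On the segment from `z` towards the centre, a vanishing differential of `u` leaves only the
  -- positive derivative of the Gaussian, so `w` would exceed `w z`.
  have hud : HasDerivWithinAt (fun t : ℝ => u (z + t • (y - z))) 0 (Ioo 0 1) 0 := by
    have h0 : HasFDerivWithinAt u (0 : E →L[ℝ] ℝ) (ball y R) (z + (0 : ℝ) • (y - z)) := by
      simpa using hder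
    exact h0.comp_hasDerivWithinAt (0 : ℝ) hline.hasDerivWithinAt hmaps
  have hexpd : HasDerivAt (fun t : ℝ => ε * Real.exp (-α * ‖z + t • (y - z) - y‖ ^ 2))
      (ε * (Real.exp (-α * R ^ 2) * (2 * (α * R ^ 2)))) 0 := by
    have h1 : (fun t : ℝ => ε * Real.exp (-α * ‖z + t • (y - z) - y‖ ^ 2))
        = fun t : ℝ => ε * Real.exp (-α * ((1 - t) ^ 2 * R ^ 2)) := by
      funext t; rw [hdist, mul_pow, sq_abs]
    rw [h1]
    have h2 : HasDerivAt (fun t : ℝ => -α * ((1 - t) ^ 2 * R ^ 2)) (2 * (α * R ^ 2)) 0 := by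
      have := ((((hasDerivAt_id (0 : ℝ)).const_sub 1).pow 2).mul_const (R ^ 2)).const_mul (-α)
      refine this.congr_deriv ?_
      simp only [id_eq]
      norm_num
      ring
    refine (h2.exp.const_mul ε).congr_deriv ?_
    simp
  have hwd := hud.add hexpd.hasDerivWithinAt
  have hmem : (0 : ℝ) ∈ closure (Ioo (0 : ℝ) 1) := by simp
  have hpos : 0 < 0 + ε * (Real.exp (-α * R ^ 2) * (2 * (α * R ^ 2))) := by positivity
  have hslope := (hasDerivWithinAt_iff_tendsto_slope' (by simp)).1 hwd
  have : NeBot (𝓝[Ioo (0 : ℝ) 1] 0) := mem_closure_iff_nhdsWithin_neBot.1 hmem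
  obtain ⟨t, ht, ht'⟩ := ((hslope.eventually_const_lt hpos).and self_mem_nhdsWithin).exists
  have h1 := hwle _ (ball_subset_closedBall (hmaps ht'))
  simp only [hw] at h1
  rw [slope_def_field] at ht
  have h2 : (u (z + t • (y - z)) + ε * Real.exp (-α * ‖z + t • (y - z) - y‖ ^ 2))
      - (M + ε * Real.exp (-α * R ^ 2)) ≤ 0 := by linarith
  refine absurd ht (not_lt.2 (div_nonpos_of_nonpos_of_nonneg ?_ (by linarith [ht'.1])))
  simpa [huz, hzR] using h2

end Analysis

/-! ### Boundary geometry of the domain and the strong maximum principle -/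

section Domain

open Metric Set Filter
open scoped Gradient RealInnerProductSpace

variable {E : Type*} [NormedAddCommGroup E] [InnerProductSpace ℝ E] [FiniteDimensional ℝ E]

theorem gradient_ne_zero {ρ : E → ℝ} {p : E} (hd : fderiv ℝ ρ p ≠ 0) : ∇ ρ p ≠ 0 := by
  intro h
  apply hd
  rw [← toDual_gradient, h, map_zero]

/-- Interior sphere condition for a sublevel set of a `C²` function at a regular point. -/
theorem exists_ball_subset_sublevel {ρ : E → ℝ} {p : E} (hρ : ContDiffAt ℝ 2 ρ p) (h0 : ρ p = 0)
    (hd : fderiv ℝ ρ p ≠ 0) {V : Set E} (hV : V ∈ 𝓝 p) :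
    ∃ (y : E) (R : ℝ), 0 < R ∧ dist p y = R ∧ ball y R ⊆ {x | x ∈ V ∧ ρ x < 0} := by
  obtain ⟨C, t, ht, hlip⟩ :=
    (hρ.fderiv_right (m := 1) (by norm_num)).exists_lipschitzOnWith
  have hdiff : ∀ᶠ x in 𝓝 p, DifferentiableAt ℝ ρ x :=
    (hρ.eventually (by norm_num)).mono fun x hx => hx.differentiableAt (by norm_num)
  obtain ⟨r, hr, hball⟩ := Metric.mem_nhds_iff.1 (inter_mem (inter_mem ht hV) hdiff)
  have hquad : ∀ x ∈ ball p r, ρ x ≤ ⟪∇ ρ p, x - p⟫ + C * ‖x - p‖ ^ 2 := by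
    intro x hx
    have hsub : closedBall p ‖x - p‖ ⊆ ball p r :=
      closedBall_subset_ball (by rwa [← dist_eq_norm])
    have := (convex_closedBall p ‖x - p‖).norm_image_sub_le_of_norm_fderiv_le' (𝕜 := ℝ)
      (f := ρ) (φ := fderiv ℝ ρ p) (C := C * ‖x - p‖) (x := p) (y := x)
      (fun q hq => (hball (hsub hq)).2) (fun q hq => ?_) (mem_closedBall_self (norm_nonneg _))
      (by rw [mem_closedBall, dist_eq_norm])
    · rw [h0, sub_zero, ← inner_gradient] at this
      have := (le_abs_self _).trans this
      linarith
    · have h1 := hlip.dist_le_mul q (hball (hsub hq)).1.1 p (mem_of_mem_nhds ht)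
      rw [dist_eq_norm] at h1
      exact h1.trans (by gcongr; exact hq)
  set g := ∇ ρ p with hg
  have hg0 : 0 < ‖g‖ := norm_pos_iff.2 (gradient_ne_zero hd)
  -- The first bound keeps the touching ball inside `ball p r`; the second lets its curvature absorb
  -- the quadratic error `C|x - p|²`. The `C + 1` below avoids division by zero.
  obtain ⟨R, hR, hRr, hRC⟩ : ∃ R : ℝ, 0 < R ∧ 2 * R ≤ r ∧ 2 * R * C ≤ ‖g‖ := by
    refine ⟨min (r / 2) (‖g‖ / (2 * (C + 1))), by positivity, ?_, ?_⟩
    · linarith [min_le_left (r / 2) (‖g‖ / (2 * (C + 1)))]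
    · have h1 := min_le_right (r / 2) (‖g‖ / (2 * (C + 1)))
      rw [le_div_iff₀ (by positivity)] at h1
      have h2 : 0 < min (r / 2) (‖g‖ / (2 * (C + 1))) := by positivity
      linarith
  have hpy : dist p (p - (R / ‖g‖) • g) = R := by
    rw [dist_eq_norm, sub_sub_cancel, norm_smul, Real.norm_of_nonneg (by positivity)]
    field_simp
  refine ⟨p - (R / ‖g‖) • g, R, hR, hpy, fun x hx => ?_⟩
  have hxp : x ∈ ball p r := by
    rw [mem_ball] at hx ⊢
    have := dist_triangle x (p - (R / ‖g‖) • g) p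
    rw [dist_comm (p - _) p, hpy] at this
    linarith
  refine ⟨(hball hxp).1.2, (hquad x hxp).trans_lt ?_⟩
  have hne : 0 < ‖x - p‖ := by
    rw [norm_pos_iff, sub_ne_zero]
    rintro rfl
    rw [mem_ball, hpy] at hx
    exact lt_irrefl _ hx
  have h1 : ‖(x - p) + (R / ‖g‖) • g‖ ^ 2 < R ^ 2 := by
    rw [mem_ball, dist_eq_norm, ← sub_add] at hx
    gcongr
  rw [norm_add_sq_real, norm_smul, Real.norm_of_nonneg (by positivity), inner_smul_right,
    real_inner_comm, div_mul_cancel₀ _ hg0.ne'] at h1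
  have h2 : ‖x - p‖ ^ 2 * ‖g‖ + 2 * R * ⟪g, x - p⟫ < 0 := by
    have h3 : ‖x - p‖ ^ 2 + 2 * (R / ‖g‖ * ⟪g, x - p⟫) < 0 := by linarith
    have h4 := mul_neg_of_neg_of_pos h3 hg0
    have h5 : (‖x - p‖ ^ 2 + 2 * (R / ‖g‖ * ⟪g, x - p⟫)) * ‖g‖
        = ‖x - p‖ ^ 2 * ‖g‖ + 2 * R * ⟪g, x - p⟫ := by field_simp
    linarith
  have h6 : 2 * R * C * ‖x - p‖ ^ 2 ≤ ‖g‖ * ‖x - p‖ ^ 2 := by gcongr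
  have h7 : 2 * R * (⟪g, x - p⟫ + C * ‖x - p‖ ^ 2) < 0 := by linarith
  exact (pos_iff_neg_of_mul_neg h7).1 (by positivity)

/-- A local defining function vanishes on the boundary. -/
theorem defining_eq_zero {X : Type*} [TopologicalSpace X] {ω U : Set X} {ρ : X → ℝ}
    (hω : IsOpen ω) (hU : IsOpen U) (hρ : ContinuousOn ρ U) (h : ω ∩ U = {x | x ∈ U ∧ ρ x < 0})
    {x : X} (hx : x ∈ frontier ω) (hxU : x ∈ U) : ρ x = 0 := by
  rw [hω.frontier_eq] at hx
  refine le_antisymm ?_ (not_lt.1 fun hlt => hx.2 (h.symm.subset ⟨hxU, hlt⟩).1)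
  have hcl : x ∈ closure (ω ∩ U) := hU.closure_inter ⟨hx.1, hxU⟩
  have hc : ContinuousWithinAt ρ (ω ∩ U) x := (hρ x hxU).mono inter_subset_right
  exact closure_minimal (t := Iic (0 : ℝ))
    (by rintro _ ⟨q, hq, rfl⟩; exact (h.subset hq).2.le) isClosed_Iic (hc.mem_closure_image hcl)

/-- Under the Neumann condition, the differential vanishes at a boundary maximum. -/
theorem gradient_eq_zero_of_isMaxOn {ω U : Set E} {ρ u : E → ℝ} {p g : E} (hU : IsOpen U)
    (hpU : p ∈ U) (hρ : DifferentiableAt ℝ ρ p) (hd : fderiv ℝ ρ p ≠ 0) (h0 : ρ p = 0)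
    (h : ω ∩ U = {x | x ∈ U ∧ ρ x < 0}) (hu : HasGradientWithinAt u g (closure ω) p)
    (hneu : ⟪g, ∇ ρ p⟫ = 0) (hmax : IsMaxOn u (closure ω) p) : g = 0 := by
  -- As `g ⊥ ∇ρ`, the derivative of `ρ` along `v` is `-|∇ρ|² < 0`, so `v` points into `ω`; that of
  -- `u` is `|g|²`, which maximality forces to be nonpositive.
  set v := g - ∇ ρ p with hv
  have hρ0 : 0 < ‖∇ ρ p‖ ^ 2 := by
    have := norm_pos_iff.2 (gradient_ne_zero hd)
    positivity
  have hline : HasDerivAt (fun t : ℝ => p + t • v) v 0 := by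
    simpa using ((hasDerivAt_id (0 : ℝ)).smul_const v).const_add p
  have hder : HasDerivAt (fun t : ℝ => ρ (p + t • v)) (-‖∇ ρ p‖ ^ 2) 0 := by
    have h1 : HasFDerivAt ρ (fderiv ℝ ρ p) (p + (0 : ℝ) • v) := by simpa using hρ.hasFDerivAt
    refine (h1.comp_hasDerivAt (0 : ℝ) hline).congr_deriv ?_
    rw [← inner_gradient, hv, inner_sub_right, real_inner_comm, hneu, real_inner_self_eq_norm_sq]
    ring
  have hUev : ∀ᶠ t : ℝ in 𝓝[>] 0, p + t • v ∈ U :=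
    nhdsWithin_le_nhds (hline.continuousAt.eventually_mem (by simpa using hU.mem_nhds hpU))
  have hneg : ∀ᶠ t : ℝ in 𝓝[>] 0, ρ (p + t • v) < 0 := by
    have hslope := (hasDerivWithinAt_iff_tendsto_slope' (by simp)).1
      (hder.hasDerivWithinAt (s := Ioi 0))
    have hlt : -‖∇ ρ p‖ ^ 2 < 0 := by linarith
    filter_upwards [hslope.eventually_lt_const hlt, self_mem_nhdsWithin] with t ht ht'
    rw [slope_def_field] at ht
    simp only [sub_zero, zero_smul, add_zero, h0] at ht
    by_contra! hcon
    exact absurd ht (not_lt.2 (div_nonneg hcon (le_of_lt ht')))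
  have hmem : v ∈ posTangentConeAt (closure ω) p := by
    refine mem_posTangentConeAt_of_frequently_mem (Eventually.frequently ?_)
    filter_upwards [hUev, hneg] with t h1 h2
    exact subset_closure (h.symm.subset ⟨h1, h2⟩).1
  have hle := hmax.localize.hasFDerivWithinAt_nonpos hu.hasFDerivWithinAt hmem
  rw [InnerProductSpace.toDual_apply_apply, hv, inner_sub_right, hneu, sub_zero,
    real_inner_self_eq_norm_sq] at hle
  have : ‖g‖ ^ 2 = 0 := le_antisymm hle (by positivity)
  simpa using this

/-- A function which is `C¹` up to the boundary has a bounded gradient. -/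
theorem exists_gradient_bound {ω : Set E} {u : E → ℝ} (hω : IsOpen ω)
    (hb : Bornology.IsBounded ω) (hu : ContDiffOn ℝ 1 u (closure ω)) :
    ∃ K : ℝ, ∀ x ∈ ω, ‖∇ u x‖ ≤ K := by
  have hcomp : IsCompact (closure ω) := hb.isCompact_closure
  suffices h : ∃ K : ℝ, ∀ x ∈ closure ω, x ∈ ω → ‖∇ u x‖ ≤ K by
    obtain ⟨K, hK⟩ := h
    exact ⟨K, fun x hx => hK x (subset_closure hx) hx⟩
  refine hcomp.induction_on (p := fun s => ∃ K : ℝ, ∀ x ∈ s, x ∈ ω → ‖∇ u x‖ ≤ K)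
    ⟨0, by simp⟩ (fun s t hst ⟨K, hK⟩ => ⟨K, fun x hx => hK x (hst hx)⟩) ?_ ?_
  · rintro s t ⟨K, hK⟩ ⟨K', hK'⟩
    refine ⟨max K K', fun x hx hxω => ?_⟩
    rcases hx with hx | hx
    · exact (hK x hx hxω).trans (le_max_left _ _)
    · exact (hK' x hx hxω).trans (le_max_right _ _)
  · intro p hp
    -- Near `p` there are derivatives within the closure that are continuous at `p`, hence locally
    -- bounded; at points of the open set `ω` they are the full derivatives.
    have h1 : ContDiffWithinAt ℝ (0 + 1) u (closure ω) p := by simpa using hu p hp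
    obtain ⟨s, hs, -, -, f', hf', hf'c⟩ :=
      (contDiffWithinAt_succ_iff_hasFDerivWithinAt' (by simp)).1 h1
    rw [insert_eq_of_mem hp] at hs
    refine ⟨s ∩ {x | ‖f' x‖ < ‖f' p‖ + 1}, inter_mem hs ?_, ‖f' p‖ + 1, fun x hx hxω => ?_⟩
    · exact hf'c.continuousWithinAt.norm.eventually_lt_const (lt_add_one _)
    · have h2 : HasFDerivAt u (f' x) x :=
        (hf' x hx.1).hasFDerivAt (mem_of_superset (hω.mem_nhds hxω) subset_closure)
      rw [← (InnerProductSpace.toDual ℝ E).norm_map, toDual_gradient, h2.fderiv]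
      exact (le_of_lt hx.2)

/-- **Strong maximum principle** with Neumann-type boundary condition, for subsolutions of the
minimal surface equation. -/
theorem eq_const_of_subsolution {ω : Set E} {u : E → ℝ} {K : ℝ} (hω : IsOpen ω)
    (hconn : IsConnected ω) (hb : Bornology.IsBounded ω) (hu : ContDiffOn ℝ 2 u ω)
    (huc : ContinuousOn u (closure ω)) (hK : ∀ x ∈ ω, ‖∇ u x‖ ≤ K)
    (hsub : ∀ x ∈ ω, 0 ≤ minimalOperator (∇ u x) (fderiv ℝ (∇ u) x).toLinearMap)
    (hbd : ∀ p ∈ frontier ω, IsMaxOn u (closure ω) p →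
      HasFDerivWithinAt u (0 : E →L[ℝ] ℝ) (closure ω) p)
    (hball : ∀ p ∈ frontier ω, ∃ (y : E) (R : ℝ), 0 < R ∧ dist p y = R ∧ ball y R ⊆ ω) :
    ∃ c : ℝ, ∀ x ∈ closure ω, u x = c := by
  obtain ⟨p, hp, hpmax⟩ := hb.isCompact_closure.exists_isMaxOn hconn.nonempty.closure huc
  have hopf : ∀ (y z : E) (R : ℝ), 0 < R → dist z y = R → ball y R ⊆ ω →
      (∀ x ∈ ball y R, u x < u p) → u z = u p →
      ¬ HasFDerivWithinAt u (0 : E →L[ℝ] ℝ) (closure ω) z := by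
    intro y z R hR hz hsubset hlt huz hder
    refine not_hasFDerivWithinAt_zero_of_max hR hz (hu.mono hsubset) (huc.mono ?_)
      (fun x hx => hK x (hsubset hx)) (fun x hx => hsub x (hsubset hx)) hlt huz
      (hder.mono (hsubset.trans subset_closure))
    rw [← closure_ball y hR.ne']
    exact closure_mono hsubset
  have hle : ∀ x ∈ ω, u x ≤ u p := fun x hx => hpmax (subset_closure hx)
  -- Around a nearby non-maximum point `q`, take the largest open ball free of maxima. It touches
  -- the set of maxima at an interior point `z`, where Hopf's lemma contradicts the vanishing
  -- differential. The radii `d/4` and `d/2` keep this ball inside `ω`.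
  have hopen : IsOpen {x | x ∈ ω ∧ u x = u p} := by
    rw [isOpen_iff_mem_nhds]
    rintro z₀ ⟨hz₀, huz₀⟩
    obtain ⟨d, hd, hdω⟩ := Metric.isOpen_iff.1 hω z₀ hz₀
    refine mem_of_superset (ball_mem_nhds z₀ (show 0 < d / 4 by positivity)) fun q hq => ?_
    rw [mem_ball] at hq
    have hqω : q ∈ ω := hdω (mem_ball.2 (by linarith))
    refine ⟨hqω, ?_⟩
    by_contra hne
    have hcbω : closedBall z₀ (d / 2) ⊆ ω := (closedBall_subset_ball (by linarith)).trans hdω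
    have hucb : ContinuousOn u (closedBall z₀ (d / 2)) := huc.mono (hcbω.trans subset_closure)
    have hZ : IsCompact (closedBall z₀ (d / 2) ∩ u ⁻¹' {u p}) :=
      (isCompact_closedBall z₀ (d / 2)).of_isClosed_subset
        (hucb.preimage_isClosed_of_isClosed isClosed_closedBall isClosed_singleton)
        inter_subset_left
    obtain ⟨z, hz, hzmin⟩ := hZ.exists_isMinOn
      ⟨z₀, mem_closedBall_self (by positivity), huz₀⟩ (continuous_dist.comp
        (Continuous.prodMk_left q)).continuousOn
    have hzz₀ : dist z q ≤ dist z₀ q :=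
      hzmin ⟨mem_closedBall_self (by positivity), huz₀⟩
    have hzω : z ∈ ω := hcbω hz.1
    have huz : u z = u p := hz.2
    have hpos : 0 < dist z q := dist_pos.2 (by rintro rfl; exact hne huz)
    have hbs : ball q (dist z q) ⊆ closedBall z₀ (d / 2) := fun x hx => by
      rw [mem_ball] at hx
      rw [mem_closedBall]
      have := dist_triangle x q z₀
      rw [dist_comm z₀ q] at hzz₀
      linarith
    refine hopf q z _ hpos rfl (hbs.trans hcbω) (fun x hx => ?_) huz ?_
    · refine lt_of_le_of_ne (hle x (hcbω (hbs hx))) fun hxp => ?_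
      exact absurd (hzmin ⟨hbs hx, hxp⟩) (not_le.2 (mem_ball.1 hx))
    · have hnz : ω ∈ 𝓝 z := hω.mem_nhds hzω
      have hloc : IsLocalMax u z := by
        filter_upwards [hnz] with x hx
        rw [huz]
        exact hle x hx
      have hdz : DifferentiableAt ℝ u z := (hu.contDiffAt hnz).differentiableAt (by norm_num)
      have := hdz.hasFDerivAt
      rw [hloc.fderiv_eq_zero] at this
      exact this.hasFDerivWithinAt
  by_cases hex : ∃ z ∈ ω, u z = u p
  · obtain ⟨z, hzω, hz⟩ := hex
    have hopen' : IsOpen {x | x ∈ ω ∧ u x ≠ u p} :=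
      (huc.mono subset_closure).isOpen_inter_preimage hω isOpen_ne
    have hall : ∀ x ∈ ω, u x = u p := by
      intro x hx
      by_contra hne
      obtain ⟨w, -, hw1, hw2⟩ := hconn.isPreconnected _ _ hopen hopen'
        (fun q hq => by by_cases h : u q = u p <;> [left; right] <;> exact ⟨hq, h⟩)
        ⟨z, hzω, hzω, hz⟩ ⟨x, hx, hx, hne⟩
      exact hw2.2 hw1.2
    refine ⟨u p, fun x hx => ?_⟩
    exact closure_minimal (t := {u p}) (by rintro _ ⟨q, hq, rfl⟩; exact hall q hq)
      isClosed_singleton (huc.image_closure (mem_image_of_mem u hx))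
  · push Not at hex
    have hpf : p ∈ frontier ω := by
      rw [hω.frontier_eq]
      exact ⟨hp, fun h => hex p h rfl⟩
    obtain ⟨y, R, hR, hpy, hsubset⟩ := hball p hpf
    exact absurd (hbd p hpf hpmax) (hopf y p R hR hpy hsubset
      (fun x hx => lt_of_le_of_ne (hle x (hsubset hx)) (hex x (hsubset hx))) rfl)

end Domain

/-! ### Tangent space, normal and mean curvature of a graph; orthogonality as a Neumann condition -/

section GraphGeometry

open Metric Set Filter
open scoped Gradient RealInnerProductSpace

/-- The velocity of a curve in `S` belongs to the tangent cone of `S`. -/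
theorem mem_tangentConeAt_of_hasDerivAt {F : Type*} [NormedAddCommGroup F] [NormedSpace ℝ F]
    {S : Set F} {γ : ℝ → F} {w : F} (hγ : HasDerivAt γ w 0) (hS : ∀ᶠ t in 𝓝 0, γ t ∈ S) :
    w ∈ tangentConeAt ℝ S (γ 0) := by
  refine mem_tangentConeAt_of_frequently (𝓝[≠] (0 : ℝ)) (fun t => t⁻¹) (fun t => γ t - γ 0) ?_ ?_ ?_
  · have : Tendsto (fun t => γ t - γ 0) (𝓝 0) (𝓝 (γ 0 - γ 0)) :=
      hγ.continuousAt.tendsto.sub_const _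
    rw [sub_self] at this
    exact this.mono_left nhdsWithin_le_nhds
  · refine Eventually.frequently (nhdsWithin_le_nhds (hS.mono fun t ht => ?_))
    simpa using ht
  · refine (hasDerivAt_iff_tendsto_slope.1 hγ).congr fun t => ?_
    simp [slope_def_module]

/-- The differential of a map into `S` takes values in the tangent cone of `S`. -/
theorem mem_tangentConeAt_of_hasFDerivAt {E F : Type*} [NormedAddCommGroup E] [NormedSpace ℝ E]
    [NormedAddCommGroup F] [NormedSpace ℝ F] {S : Set F} {γ : E → F} {γ' : E →L[ℝ] F} {x : E}
    (hγ : HasFDerivAt γ γ' x) (hS : ∀ᶠ y in 𝓝 x, γ y ∈ S) (v : E) :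
    γ' v ∈ tangentConeAt ℝ S (γ x) := by
  have hline : HasDerivAt (fun t : ℝ => x + t • v) v 0 := by
    simpa using ((hasDerivAt_id (0 : ℝ)).smul_const v).const_add x
  have h0 : HasFDerivAt γ γ' (x + (0 : ℝ) • v) := by simpa using hγ
  have hcont : Tendsto (fun t : ℝ => x + t • v) (𝓝 0) (𝓝 x) := by
    simpa [ContinuousAt] using hline.continuousAt
  simpa using mem_tangentConeAt_of_hasDerivAt (h0.comp_hasDerivAt (0 : ℝ) hline)
    (hcont.eventually hS)

/-- Differentials within `S` are unique on the tangent space of `S`. -/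
theorem eq_of_mem_tangentSpaceAt {F G : Type*} [NormedAddCommGroup F]
    [InnerProductSpace ℝ F] [NormedAddCommGroup G] [NormedSpace ℝ G] {S : Set F} {p w : F}
    {f : F → G} {f₁ f₂ : F →L[ℝ] G} (h₁ : HasFDerivWithinAt f f₁ S p)
    (h₂ : HasFDerivWithinAt f f₂ S p) (hw : w ∈ tangentSpaceAt S p) : f₁ w = f₂ w := by
  have h : tangentSpaceAt S p ≤ LinearMap.eqLocus f₁.toLinearMap f₂.toLinearMap :=
    Submodule.span_le.2 fun v hv => h₁.unique_on h₂ hv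
  exact h hw

/-- A function vanishing on `S` near `p` has vanishing differential on the tangent space. -/
theorem apply_eq_zero_of_mem_tangentSpaceAt {F : Type*} [NormedAddCommGroup F]
    [InnerProductSpace ℝ F] {S : Set F} {p w : F} {f : F → ℝ} {f' : F →L[ℝ] ℝ}
    (hf : HasFDerivWithinAt f f' S p) (h0 : f =ᶠ[𝓝[S] p] 0) (hp : f p = 0)
    (hw : w ∈ tangentSpaceAt S p) : f' w = 0 := by
  have h1 : HasFDerivWithinAt f (0 : F →L[ℝ] ℝ) S p :=
    (hasFDerivWithinAt_const (0 : ℝ) p S).congr_of_eventuallyEq h0 hp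
  exact eq_of_mem_tangentSpaceAt hf h1 hw

variable {n : ℕ}

/-- Tangent vectors of a graph satisfy the linearized equation of the graph. -/
theorem snd_eq_of_mem_tangentSpaceAt {A : Set (Base n)} {S : Set (Ambient n)} {φ : Base n → ℝ}
    {x g : Base n} (hφ : HasGradientWithinAt φ g A x)
    (hS : ∀ y ∈ S, y.fst ∈ A ∧ y.snd = φ y.fst) {w : Ambient n}
    (hw : w ∈ tangentSpaceAt S (WithLp.toLp 2 (x, φ x))) : w.snd = ⟪g, w.fst⟫ := by
  set p : Ambient n := WithLp.toLp 2 (x, φ x) with hp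
  have h1 : HasFDerivWithinAt (fun y : Ambient n => φ y.fst - y.snd)
      ((InnerProductSpace.toDual ℝ (Base n) g).comp (WithLp.fstL 2 ℝ (Base n) ℝ)
        - WithLp.sndL 2 ℝ (Base n) ℝ) S p := by
    refine HasFDerivWithinAt.sub ?_ (WithLp.sndL 2 ℝ (Base n) ℝ).hasFDerivWithinAt
    exact HasFDerivWithinAt.comp (t := A) p hφ.hasFDerivWithinAt
      (WithLp.fstL 2 ℝ (Base n) ℝ).hasFDerivWithinAt fun y hy => (hS y hy).1
  have h2 := apply_eq_zero_of_mem_tangentSpaceAt h1 (eventually_mem_nhdsWithin.mono fun y hy => by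
    simp [(hS y hy).2]) (by simp [hp, WithLp.fst, WithLp.snd]) hw
  have h3 : ⟪g, w.fst⟫ - w.snd = 0 := h2
  linarith

theorem mem_tangentSpaceAt_graph_iff {ω : Set (Base n)} (hω : IsOpen ω) {φ : Base n → ℝ}
    {x : Base n} (hx : x ∈ ω) (hφ : DifferentiableAt ℝ φ x) {w : Ambient n} :
    w ∈ tangentSpaceAt (graph ω φ) (WithLp.toLp 2 (x, φ x)) ↔ w.snd = ⟪∇ φ x, w.fst⟫ := by
  refine ⟨snd_eq_of_mem_tangentSpaceAt (A := ω)
    (hasGradientWithinAt_iff_hasFDerivWithinAt.2 hφ.hasGradientAt.hasFDerivAt.hasFDerivWithinAt)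
    fun y hy => hy, fun hw => Submodule.subset_span ?_⟩
  have hγ : HasFDerivAt (fun y => (WithLp.toLp 2 (y, φ y) : Ambient n))
      ((WithLp.prodContinuousLinearEquiv 2 ℝ (Base n) ℝ).symm.toContinuousLinearMap.comp
        ((ContinuousLinearMap.id ℝ (Base n)).prod (fderiv ℝ φ x))) x :=
    (WithLp.prodContinuousLinearEquiv 2 ℝ (Base n) ℝ).symm.hasFDerivAt.comp x
      ((hasFDerivAt_id x).prodMk hφ.hasFDerivAt)
  have hmem := mem_tangentConeAt_of_hasFDerivAt (S := graph ω φ) hγ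
    ((hω.eventually_mem hx).mono fun y hy => ⟨hy, rfl⟩) w.fst
  convert hmem using 1
  refine congrArg (WithLp.toLp 2) (Prod.ext rfl ?_)
  exact hw.trans (inner_gradient x w.fst)

/-- The upward unit normal of the graph of `φ`, as a function on the base. -/
def graphNormal (φ : Base n → ℝ) (x : Base n) : Ambient n :=
  WithLp.toLp 2 (-((√(1 + ‖∇ φ x‖ ^ 2))⁻¹ • ∇ φ x), (√(1 + ‖∇ φ x‖ ^ 2))⁻¹)

/-- The exterior unit normal of a graph is the upward one. -/
theorem exteriorNormal_eq_graphNormal {ω : Set (Base n)} (hω : IsOpen ω) {φ : Base n → ℝ}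
    {x : Base n} (hx : x ∈ ω) (hφ : DifferentiableAt ℝ φ x) {ν : Ambient n → Ambient n}
    (hν : IsExteriorUnitNormal (subgraph ω φ) (graph ω φ) ν) :
    ν (WithLp.toLp 2 (x, φ x)) = graphNormal φ x := by
  set p : Ambient n := WithLp.toLp 2 (x, φ x) with hp
  have hpΓ : p ∈ graph ω φ := ⟨hx, rfl⟩
  set g := ∇ φ x with hg
  set b := (ν p).snd with hb
  have hfst : (ν p).fst = -(b • g) := by
    rw [eq_neg_iff_add_eq_zero]
    refine ext_inner_left ℝ fun v => ?_
    have hv : (WithLp.toLp 2 (v, ⟪g, v⟫) : Ambient n) ∈ tangentSpaceAt (graph ω φ) p :=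
      (mem_tangentSpaceAt_graph_iff hω hx hφ).2 rfl
    have h1 := (Submodule.mem_orthogonal _ _).1 (hν.normal p hpΓ) _ hv
    have h2 : ⟪v, (ν p).fst⟫ + ⟪g, v⟫ * b = 0 := by
      have h3 : ⟪v, (ν p).fst⟫ + b * ⟪g, v⟫ = 0 := h1
      linarith
    rw [inner_add_right, inner_smul_right, inner_zero_right, real_inner_comm g v]
    linarith
  have hnorm : b ^ 2 * (1 + ‖g‖ ^ 2) = 1 := by
    have h1 := WithLp.prod_norm_sq_eq_of_L2 (ν p)
    rw [hν.norm_eq_one p hpΓ, hfst, ← hb, norm_neg, norm_smul, mul_pow] at h1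
    simp only [Real.norm_eq_abs, sq_abs] at h1
    linarith
  have hb0 : b ≠ 0 := by
    rintro h
    rw [h] at hnorm
    simp at hnorm
  -- The point `p - tν` lies below the graph, so `φ(x + t b g) + t b > φ x` for small `t > 0`; the
  -- left side has derivative `b(1 + |g|²)` at `0`, so `b` cannot be negative.
  have hbpos : 0 < b := by
    by_contra! hneg
    have hlt : b < 0 := lt_of_le_of_ne hneg hb0
    have hline : HasDerivAt (fun t : ℝ => x + t • (b • g)) (b • g) 0 := by
      simpa using ((hasDerivAt_id (0 : ℝ)).smul_const (b • g)).const_add x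
    have hder : HasDerivAt (fun t : ℝ => φ (x + t • (b • g)) + t * b) (b * ‖g‖ ^ 2 + b) 0 := by
      refine HasDerivAt.add ?_ (by simpa using (hasDerivAt_id (0 : ℝ)).mul_const b)
      have h1 : HasFDerivAt φ (fderiv ℝ φ x) (x + (0 : ℝ) • (b • g)) := by
        simpa using hφ.hasFDerivAt
      refine (h1.comp_hasDerivAt (0 : ℝ) hline).congr_deriv ?_
      rw [← inner_gradient, inner_smul_right, real_inner_self_eq_norm_sq]
    have hslope := (hasDerivWithinAt_iff_tendsto_slope' (by simp)).1
      (hder.hasDerivWithinAt (s := Ioi 0))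
    have hlt' : b * ‖g‖ ^ 2 + b < 0 := by nlinarith [sq_nonneg ‖g‖]
    obtain ⟨t, ⟨ht, ht''⟩, ht'⟩ := (((hslope.eventually_lt_const hlt').and
      (hν.inside p hpΓ)).and self_mem_nhdsWithin).exists
    have h1 := ht''.2.2
    have h2 : φ x - t * b < φ (x - t • (ν p).fst) := h1
    rw [hfst, smul_neg, sub_neg_eq_add] at h2
    rw [slope_def_field] at ht
    refine absurd ht (not_lt.2 (div_nonneg ?_ (by simpa using le_of_lt ht')))
    simp only [zero_smul, add_zero, zero_mul]
    linarith
  have hbW : b = (√(1 + ‖g‖ ^ 2))⁻¹ := by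
    rw [← Real.sqrt_inv, eq_comm, Real.sqrt_eq_iff_mul_self_eq (by positivity) hbpos.le]
    field_simp
    linarith
  have h1 : ν p = WithLp.toLp 2 ((ν p).fst, (ν p).snd) := rfl
  rw [h1, hfst, ← hb, hbW]
  rfl

/-- Differential of the upward unit normal, in terms of the gradient and the Hessian of `φ`. -/
theorem hasFDerivAt_graphNormal {φ : Base n → ℝ} {x : Base n} (hφ : ContDiffAt ℝ 2 φ x) :
    ∃ D : Base n →L[ℝ] Ambient n, HasFDerivAt (graphNormal φ) D x ∧ ∀ v,
      D v = WithLp.toLp 2 (-((√(1 + ‖∇ φ x‖ ^ 2))⁻¹ • fderiv ℝ (∇ φ) x v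
          - ((√(1 + ‖∇ φ x‖ ^ 2))⁻¹ ^ 3 * ⟪∇ φ x, fderiv ℝ (∇ φ) x v⟫) • ∇ φ x),
        -((√(1 + ‖∇ φ x‖ ^ 2))⁻¹ ^ 3 * ⟪∇ φ x, fderiv ℝ (∇ φ) x v⟫)) := by
  have hg := (differentiableAt_gradient hφ).hasFDerivAt
  set L := fderiv ℝ (∇ φ) x
  have hpos : 0 < 1 + ‖∇ φ x‖ ^ 2 := by positivity
  have hs : HasFDerivAt (fun y => (√(1 + ‖∇ φ y‖ ^ 2))⁻¹)
      (-((√(1 + ‖∇ φ x‖ ^ 2))⁻¹ ^ 3) • (innerSL ℝ (∇ φ x)).comp L) x := by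
    have h1 := ((hg.norm_sq.const_add 1).sqrt hpos.ne')
    have h2 := (hasDerivAt_inv (Real.sqrt_pos.2 hpos).ne').comp_hasFDerivAt x h1
    refine h2.congr_fderiv ?_
    ext v
    simp only [smul_apply, ContinuousLinearMap.comp_apply, smul_eq_mul,
      nsmul_eq_mul]
    have := (Real.sqrt_pos.2 hpos).ne'
    field_simp
    push_cast
    ring
  have h3 := (hs.smul hg).neg.prodMk hs
  refine ⟨_, (WithLp.prodContinuousLinearEquiv 2 ℝ (Base n) ℝ).symm.hasFDerivAt.comp x h3, ?_⟩
  intro v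
  simp only [ContinuousLinearMap.comp_apply, ContinuousLinearMap.prod_apply]
  refine congrArg (WithLp.toLp 2) (Prod.ext ?_ ?_)
  · simp [sub_eq_add_neg]
  · simp

/-- The mean curvature of a graph in terms of the minimal surface operator. -/
theorem minimalOperator_eq_of_meanCurvature {ω : Set (Base n)} (hn : 1 ≤ n) (hω : IsOpen ω)
    {φ : Base n → ℝ} (hφ : ContDiffOn ℝ 2 φ ω) {H : ℝ}
    (hH : HasConstantMeanCurvature (subgraph ω φ) (graph ω φ) H) {x : Base n} (hx : x ∈ ω) :
    minimalOperator (∇ φ x) (fderiv ℝ (∇ φ) x).toLinearMap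
      = -(n * H * √(1 + ‖∇ φ x‖ ^ 2) ^ 3) := by
  obtain ⟨ν, hν, hνd, hνH⟩ := hH
  have hd : ∀ y ∈ ω, DifferentiableAt ℝ φ y := fun y hy =>
    (hφ.contDiffAt (hω.mem_nhds hy)).differentiableAt (by norm_num)
  set p : Ambient n := WithLp.toLp 2 (x, φ x) with hp
  have hpΓ : p ∈ graph ω φ := ⟨hx, rfl⟩
  have hνeq : ∀ q ∈ graph ω φ, ν q = graphNormal φ q.fst := by
    intro q hq
    rw [← exteriorNormal_eq_graphNormal hω hq.1 (hd _ hq.1) hν, ← hq.2]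
    rfl
  obtain ⟨D, hD, hDv⟩ := hasFDerivAt_graphNormal (hφ.contDiffAt (hω.mem_nhds hx))
  set g := ∇ φ x with hg
  set L := fderiv ℝ (∇ φ) x with hL
  set s := (√(1 + ‖g‖ ^ 2))⁻¹ with hs
  have hW : 0 < √(1 + ‖g‖ ^ 2) := Real.sqrt_pos.2 (by positivity)
  have hs2 : s ^ 2 * (1 + ‖g‖ ^ 2) = 1 := by
    rw [hs, inv_pow, Real.sq_sqrt (by positivity), inv_mul_cancel₀ (by positivity)]
  have hder : HasFDerivWithinAt ν (D.comp (WithLp.fstL 2 ℝ (Base n) ℝ)) (graph ω φ) p := by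
    have h1 : HasFDerivAt (fun q : Ambient n => graphNormal φ q.fst)
        (D.comp (WithLp.fstL 2 ℝ (Base n) ℝ)) p :=
      HasFDerivAt.comp (g := graphNormal φ) (f := WithLp.fstL 2 ℝ (Base n) ℝ) p hD
        (WithLp.fstL 2 ℝ (Base n) ℝ).hasFDerivAt
    exact h1.hasFDerivWithinAt.congr hνeq (hνeq p hpΓ)
  set T := tangentSpaceAt (graph ω φ) p with hT
  have hmem : ∀ w : Ambient n, w ∈ T ↔ w.snd = ⟪g, w.fst⟫ := fun w =>
    mem_tangentSpaceAt_graph_iff hω hx (hd x hx)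
  -- A derivative within the graph is determined only on the tangent space, which is all that the
  -- shape operator sees.
  have hagree : ∀ w ∈ T, fderivWithin ℝ ν (graph ω φ) p w = D w.fst := fun w hw =>
    eq_of_mem_tangentSpaceAt (hνd p hpΓ).hasFDerivWithinAt hder hw
  have hDT : ∀ v, D v ∈ T := by
    intro v
    rw [hmem, hDv]
    change -(s ^ 3 * ⟪g, L v⟫) = ⟪g, -(s • L v - (s ^ 3 * ⟪g, L v⟫) • g)⟫
    rw [inner_neg_right, inner_sub_right, inner_smul_right, inner_smul_right,
      real_inner_self_eq_norm_sq]
    linear_combination (-(s * ⟪g, L v⟫)) * hs2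
  -- Projection to the base turns the shape operator into the explicit endomorphism `A`. It is not
  -- an isometry, but the trace is invariant under conjugation.
  let e : T ≃ₗ[ℝ] Base n := LinearEquiv.ofBijective
    ((WithLp.fstₗ 2 ℝ (Base n) ℝ).comp T.subtype) (by
      constructor
      · intro w w' h
        have h1 : (w : Ambient n).fst = (w' : Ambient n).fst := h
        have h2 : (w : Ambient n).snd = (w' : Ambient n).snd := by
          rw [(hmem w).1 w.2, (hmem w').1 w'.2, h1]
        exact Subtype.ext (congrArg (WithLp.toLp 2) (Prod.ext h1 h2))
      · intro v
        exact ⟨⟨WithLp.toLp 2 (v, ⟪g, v⟫), (hmem _).2 rfl⟩, rfl⟩)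
  let A : Base n →ₗ[ℝ] Base n :=
    -(s • L.toLinearMap - (s ^ 3) • ((innerₗ (Base n) g).comp L.toLinearMap).smulRight g)
  have hconj : e.conj (shapeOperator (graph ω φ) ν p) = A := by
    refine LinearMap.ext fun v => ?_
    obtain ⟨w, rfl⟩ := e.surjective v
    rw [LinearEquiv.conj_apply_apply, LinearEquiv.symm_apply_apply]
    have h1 : shapeOperator (graph ω φ) ν p w = ⟨D (w : Ambient n).fst, hDT _⟩ := by
      change T.orthogonalProjectionOnto (fderivWithin ℝ ν (graph ω φ) p w) = _
      rw [hagree w w.2]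
      exact T.orthogonalProjectionOnto_mem_subspace_eq_self ⟨D (w : Ambient n).fst, hDT _⟩
    rw [h1]
    change (D (w : Ambient n).fst).fst = A (w : Ambient n).fst
    rw [hDv]
    change -(s • L (w : Ambient n).fst - (s ^ 3 * ⟪g, L (w : Ambient n).fst⟫) • g)
      = -(s • L (w : Ambient n).fst - s ^ 3 • (⟪g, L (w : Ambient n).fst⟫ • g))
    rw [smul_smul]
  have htrace : LinearMap.trace ℝ T (shapeOperator (graph ω φ) ν p)
      = -(s ^ 3 * minimalOperator g L.toLinearMap) := by
    rw [← LinearMap.trace_conj' _ e, hconj]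
    simp only [A, map_neg, map_sub, map_smul, LinearMap.trace_smulRight, LinearMap.comp_apply,
      innerₗ_apply_apply, smul_eq_mul, minimalOperator]
    linear_combination (s * LinearMap.trace ℝ (Base n) L.toLinearMap) * hs2
  have hrank : Module.finrank ℝ T = n := by
    rw [e.finrank_eq, finrank_euclideanSpace, Fintype.card_fin]
  have hHp := hνH p hpΓ
  rw [meanCurvature, htrace, hrank, div_eq_iff (by positivity)] at hHp
  have hsW : s * √(1 + ‖g‖ ^ 2) = 1 := inv_mul_cancel₀ hW.ne'
  have hsW3 : s ^ 3 * √(1 + ‖g‖ ^ 2) ^ 3 = 1 := by rw [← mul_pow, hsW, one_pow]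
  linear_combination (-√(1 + ‖g‖ ^ 2) ^ 3) * hHp - minimalOperator g L.toLinearMap * hsW3

/-- The orthogonality condition is the Neumann condition. -/
theorem inner_eq_zero_of_meetsOrthogonally {ω : Set (Base n)} (hω : IsOpen ω) {φ : Base n → ℝ}
    (hφ : ContinuousOn φ (closure ω)) (hpos : ∀ x ∈ closure ω, 0 < φ x)
    (horth : MeetsOrthogonally (graph ω φ) (lateralBoundary ω)) {x g : Base n}
    (hx : x ∈ frontier ω) (hg : HasGradientWithinAt φ g (closure ω) x) {U : Set (Base n)}
    {ρ : Base n → ℝ} (hU : IsOpen U) (hxU : x ∈ U) (hρ : ContinuousOn ρ U)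
    (hρd : DifferentiableAt ℝ ρ x) (h : ω ∩ U = {y | y ∈ U ∧ ρ y < 0}) : ⟪g, ∇ ρ x⟫ = 0 := by
  set p : Ambient n := WithLp.toLp 2 (x, φ x) with hp
  have hxcl : x ∈ closure ω := frontier_subset_closure hx
  have hfst : Continuous fun y : Ambient n => y.fst := (WithLp.fstL 2 ℝ (Base n) ℝ).continuous
  have hsnd : Continuous fun y : Ambient n => y.snd := (WithLp.sndL 2 ℝ (Base n) ℝ).continuous
  have hopen : IsOpen (halfCylinder ω) :=
    (hω.preimage hfst).inter (isOpen_Ioi.preimage hsnd)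
  have hclosed : IsClosed {y : Ambient n | y.fst ∈ closure ω ∧ y.snd = φ y.fst} := by
    have h1 : ContinuousOn (fun y : Ambient n => y.snd - φ y.fst)
        ((fun y : Ambient n => y.fst) ⁻¹' closure ω) :=
      hsnd.continuousOn.sub (hφ.comp hfst.continuousOn fun y hy => hy)
    have h2 := h1.preimage_isClosed_of_isClosed (isClosed_closure.preimage hfst)
      (isClosed_singleton (x := (0 : ℝ)))
    convert h2 using 1
    ext y
    simp [sub_eq_zero]
  have hclΓ : ∀ y ∈ closure (graph ω φ), y.fst ∈ closure ω ∧ y.snd = φ y.fst :=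
    closure_minimal (fun y hy => ⟨subset_closure hy.1, hy.2⟩) hclosed
  have hpcl : p ∈ closure (graph ω φ) := by
    have h1 : ContinuousWithinAt (fun y => (WithLp.toLp 2 (y, φ y) : Ambient n)) ω x :=
      (WithLp.prodContinuousLinearEquiv 2 ℝ (Base n) ℝ).symm.continuous.continuousAt
        |>.comp_continuousWithinAt
        (continuousWithinAt_id.prodMk ((hφ x hxcl).mono subset_closure))
    exact closure_mono (by rintro _ ⟨y, hy, rfl⟩; exact ⟨hy, rfl⟩) (h1.mem_closure_image hxcl)
  have hlat : ∀ y ∈ lateralBoundary ω, y.fst ∈ frontier ω := by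
    rintro y ⟨hy, hy0⟩
    rw [hopen.frontier_eq] at hy
    rw [hω.frontier_eq]
    refine ⟨?_, fun h' => hy.2 ⟨h', hy0⟩⟩
    exact closure_minimal (t := (fun y : Ambient n => y.fst) ⁻¹' closure ω)
      (fun q hq => subset_closure hq.1) (isClosed_closure.preimage hfst) hy.1
  have hsub : graph ω φ ⊆ halfCylinder ω := fun y hy =>
    ⟨hy.1, by rw [hy.2]; exact hpos _ (subset_closure hy.1)⟩
  have hplat : p ∈ lateralBoundary ω := by
    refine ⟨?_, hpos x hxcl⟩
    rw [hopen.frontier_eq]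
    rw [hω.frontier_eq] at hx
    exact ⟨closure_mono hsub hpcl,
      fun h' => hx.2 h'.1⟩
  -- The normals `(g, -1)` to the graph and `(∇ρ, 0)` to the cylinder have inner product `⟨g, ∇ρ⟩`.
  have ha : (WithLp.toLp 2 (g, -1) : Ambient n) ∈ normalSpaceAt (closure (graph ω φ)) p := by
    refine (Submodule.mem_orthogonal _ _).2 fun w hw => ?_
    have h1 := snd_eq_of_mem_tangentSpaceAt hg hclΓ hw
    change ⟪w.fst, g⟫ + -1 * w.snd = 0
    rw [h1, real_inner_comm]
    ring
  have hb : (WithLp.toLp 2 (∇ ρ x, 0) : Ambient n) ∈ normalSpaceAt (lateralBoundary ω) p := by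
    refine (Submodule.mem_orthogonal _ _).2 fun w hw => ?_
    have h1 : HasFDerivAt (fun y : Ambient n => ρ y.fst)
        ((fderiv ℝ ρ x).comp (WithLp.fstL 2 ℝ (Base n) ℝ)) p :=
      HasFDerivAt.comp (g := ρ) (f := WithLp.fstL 2 ℝ (Base n) ℝ) p hρd.hasFDerivAt
        (WithLp.fstL 2 ℝ (Base n) ℝ).hasFDerivAt
    have h2 : fderiv ℝ ρ x w.fst = 0 := by
      refine apply_eq_zero_of_mem_tangentSpaceAt (w := w) (S := lateralBoundary ω)
        h1.hasFDerivWithinAt ?_ (defining_eq_zero hω hU hρ h hx hxU) hw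
      have h3 : ∀ᶠ y : Ambient n in 𝓝[lateralBoundary ω] p, y.fst ∈ U :=
        nhdsWithin_le_nhds (hfst.continuousAt.eventually_mem (hU.mem_nhds hxU))
      filter_upwards [h3, self_mem_nhdsWithin] with y hy hy'
      exact defining_eq_zero hω hU hρ h (hlat y hy') hy
    change ⟪w.fst, ∇ ρ x⟫ + 0 * w.snd = 0
    rw [real_inner_comm, inner_gradient, h2]
    ring
  have h1 : ⟪g, ∇ ρ x⟫ + 0 * (-1) = 0 := horth p ⟨hpcl, hplat⟩ _ ha _ hb
  linarith

end GraphGeometry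

/-! ### Rigidity under the Neumann condition, and the sign change `u ↦ -u` -/

section Rigidity

open Metric Set Filter
open scoped Gradient RealInnerProductSpace

variable {n : ℕ}

/-- Subsolutions of the minimal surface equation on a smooth bounded domain which satisfy the
homogeneous Neumann condition are constant. -/
theorem eq_const_of_subsolution_of_neumann {ω : Set (Base n)} (hω : IsSmoothBoundedDomain ω)
    {u : Base n → ℝ} (hu : ContDiffOn ℝ 2 u (closure ω))
    (hsub : ∀ x ∈ ω, 0 ≤ minimalOperator (∇ u x) (fderiv ℝ (∇ u) x).toLinearMap)
    (hneu : ∀ x ∈ frontier ω, ∀ g, HasGradientWithinAt u g (closure ω) x →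
      ∀ (U : Set (Base n)) (ρ : Base n → ℝ), IsOpen U → x ∈ U → ContinuousOn ρ U →
        DifferentiableAt ℝ ρ x → ω ∩ U = {y | y ∈ U ∧ ρ y < 0} → ⟪g, ∇ ρ x⟫ = 0) :
    ∃ c : ℝ, ∀ x ∈ closure ω, u x = c := by
  obtain ⟨K, hK⟩ := exists_gradient_bound hω.isOpen hω.isBounded (hu.of_le (by norm_num))
  refine eq_const_of_subsolution hω.isOpen hω.isConnected hω.isBounded (hu.mono subset_closure)
    hu.continuousOn hK hsub (fun p hp hmax => ?_) (fun p hp => ?_)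
  · obtain ⟨U, ρ, hU, hpU, hρ, hd, h⟩ := hω.smooth_boundary p hp
    have hρd : DifferentiableAt ℝ ρ p :=
      (hρ.contDiffAt (hU.mem_nhds hpU)).differentiableAt (by simp)
    have hgrad := ((hu p (frontier_subset_closure hp)).differentiableWithinAt
      (by norm_num)).hasGradientWithinAt
    have hg := gradient_eq_zero_of_isMaxOn hU hpU hρd hd
      (defining_eq_zero hω.isOpen hU hρ.continuousOn h hp hpU) h hgrad
      (hneu p hp _ hgrad U ρ hU hpU hρ.continuousOn hρd h) hmax
    rw [hg] at hgrad
    simpa using hgrad.hasFDerivWithinAt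
  · obtain ⟨U, ρ, hU, hpU, hρ, hd, h⟩ := hω.smooth_boundary p hp
    have hρ2 : ContDiffAt ℝ 2 ρ p := (hρ.contDiffAt (hU.mem_nhds hpU)).of_le 
      (WithTop.coe_le_coe.2 (le_top : (2 : ℕ∞) ≤ ⊤))
    obtain ⟨y, R, hR, hpy, hball⟩ := exists_ball_subset_sublevel hρ2
      (defining_eq_zero hω.isOpen hU hρ.continuousOn h hp hpU) hd (hU.mem_nhds hpU)
    exact ⟨y, R, hR, hpy, fun x hx => (h.symm.subset (hball hx)).1⟩

theorem gradient_neg_eq {E : Type*} [NormedAddCommGroup E] [InnerProductSpace ℝ E]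
    [CompleteSpace E] (u : E → ℝ) : ∇ (fun x => -u x) = fun x => -∇ u x := by
  funext x
  apply (InnerProductSpace.toDual ℝ E).injective
  rw [map_neg, toDual_gradient, toDual_gradient, fderiv_fun_neg]

/-- Oddness exchanges subsolutions and supersolutions, which reduces `H ≥ 0` to the subsolution
case. -/
theorem minimalOperator_neg {E : Type*} [NormedAddCommGroup E] [InnerProductSpace ℝ E]
    (g : E) (M : E →ₗ[ℝ] E) : minimalOperator (-g) (-M) = -minimalOperator g M := by
  simp only [minimalOperator, norm_neg, map_neg, LinearMap.neg_apply, inner_neg_left,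
    inner_neg_right]
  ring

end Rigidity

end CMCGraph

end

open Set

open scoped Gradient

theorem proposition2p1 (n : ℕ) (hn : 1 ≤ n)
    (ω : Set (CMCGraph.Base n)) (hω : CMCGraph.IsSmoothBoundedDomain ω)
    (φ : CMCGraph.Base n → ℝ) (hφ : ContDiffOn ℝ 2 φ (closure ω))
    (hpos : ∀ x ∈ closure ω, 0 < φ x)
    (H : ℝ)
    (hH : CMCGraph.HasConstantMeanCurvature (CMCGraph.subgraph ω φ) (CMCGraph.graph ω φ) H)
    (horth : CMCGraph.MeetsOrthogonally (CMCGraph.graph ω φ) (CMCGraph.lateralBoundary ω)) :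
    H = 0 ∧ ∃ c : ℝ, ∀ x ∈ closure ω, φ x = c := by
  have hop : ∀ x ∈ ω, CMCGraph.minimalOperator (∇ φ x) (fderiv ℝ (∇ φ) x).toLinearMap
      = -(n * H * √(1 + ‖∇ φ x‖ ^ 2) ^ 3) := fun x hx =>
    CMCGraph.minimalOperator_eq_of_meanCurvature hn hω.isOpen (hφ.mono subset_closure) hH hx
  have hneu : ∀ x ∈ frontier ω, ∀ g, HasGradientWithinAt φ g (closure ω) x →
      ∀ (U : Set (CMCGraph.Base n)) (ρ : CMCGraph.Base n → ℝ), IsOpen U → x ∈ U →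
        ContinuousOn ρ U → DifferentiableAt ℝ ρ x → ω ∩ U = {y | y ∈ U ∧ ρ y < 0} →
          inner ℝ g (∇ ρ x) = 0 := fun x hx g hg U ρ hU hxU hρ hρd h =>
    CMCGraph.inner_eq_zero_of_meetsOrthogonally hω.isOpen hφ.continuousOn hpos horth hx hg hU hxU
      hρ hρd h
  have hconst : ∃ c : ℝ, ∀ x ∈ closure ω, φ x = c := by
    rcases le_total H 0 with hH0 | hH0
    · refine CMCGraph.eq_const_of_subsolution_of_neumann hω hφ (fun x hx => ?_) hneu
      rw [hop x hx, neg_nonneg]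
      exact mul_nonpos_of_nonpos_of_nonneg (mul_nonpos_of_nonneg_of_nonpos (by positivity) hH0)
        (by positivity)
    · suffices h : ∃ c : ℝ, ∀ x ∈ closure ω, -φ x = c by
        obtain ⟨c, hc⟩ := h
        exact ⟨-c, fun x hx => by rw [← hc x hx, neg_neg]⟩
      refine CMCGraph.eq_const_of_subsolution_of_neumann hω hφ.neg (fun x hx => ?_)
        (fun x hx g hg U ρ hU hxU hρ hρd h => ?_)
      · rw [CMCGraph.gradient_neg_eq, fderiv_fun_neg, ContinuousLinearMap.toLinearMap_neg,
          CMCGraph.minimalOperator_neg, hop x hx, neg_neg]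
        positivity
      · have hg' : HasGradientWithinAt φ (-g) (closure ω) x := by
          rw [hasGradientWithinAt_iff_hasFDerivWithinAt, map_neg]
          simpa using hg.hasFDerivWithinAt.fun_neg
        simpa using hneu x hx (-g) hg' U ρ hU hxU hρ hρd h
  refine ⟨?_, hconst⟩
  obtain ⟨c, hc⟩ := hconst
  obtain ⟨x, hx⟩ := hω.isConnected.nonempty
  have hgrad : ∀ y ∈ ω, ∇ φ y = 0 := by
    intro y hy
    have h1 : φ =ᶠ[𝓝 y] fun _ => c :=
      (hω.isOpen.eventually_mem hy).mono fun q hq => hc q (subset_closure hq)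
    rw [gradient, h1.fderiv_eq, fderiv_fun_const]
    simp
  have hhess : fderiv ℝ (∇ φ) x = 0 := by
    have h1 : ∇ φ =ᶠ[𝓝 x] fun _ => 0 := (hω.isOpen.eventually_mem hx).mono hgrad
    rw [h1.fderiv_eq, fderiv_fun_const]
    rfl
  -- For constant `φ` the curvature equation at a single point reduces to `0 = -(n H)`.
  have h := hop x hx
  rw [hhess, hgrad x hx] at h
  have hn0 : (n : ℝ) ≠ 0 := by positivity
  simpa [CMCGraph.minimalOperator, hn0] using h
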